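/- For $n\ge 0$ let $R_n$ be the rook monoid, i.e. the set of all injective partial functions $s$ from $\{1,\dots,n\}$ to itself, ordered by extension, with $\mathrm{rk}(s)=|\mathrm{dom}(s)|$. For $f:R_n\to\mathbb C$ let $\zeta_f(s)=\sum_{t\ge s}f(t)$. For $s$ of rank $k$ let $d_1(s)<\dots<d_{n-k}(s)$ and $r_1(s)<\dots<r_{n-k}(s)$ be the elements of $\{1,\dots,n\}$ outside $\mathrm{dom}(s)$ and outside $\mathrm{ran}(s)$, and for $0\le m\le n-k$ let $$\zeta_f^{m}(s)=\sum_{\substack{t\ge s\\ d_1(s),\dots,d_m(s)\notin\mathrm{dom}(t)\\ r_1(s),\dots,r_m(s)\notin\mathrm{ran}(t)}}f(t),$$ so that $\zeta_f^0(s)=\zeta_f(s)$ and $\zeta_f^{n-k}(s)=f(s)$. For $d\notin \mathrm{dom}(s)$ and $r\notin \mathrm{ran}(s)$ write $s*(d\to r)$ for the extension of $s$ that sends $d$ to $r$. The fast zeta transform on $R_n$ is the following algorithm. Its memory initially holds the numbers $f(s)$, $s\in R_n$. It performs steps $n-k$ for $k=n,n-1,\dots,0$. Step $n-k$ first discards the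 numbers $\zeta_f^m(t)$ with $\mathrm{rk}(t)\ge k+3$ and $0<m<n-\mathrm{rk}(t)$. Then, for all $s$ of rank $k$, in any order, it computes and stores $\zeta_f^m(s)$ for $m=n-k-1,\dots,0$ in this order (for $k=n$ it stores $\zeta_f(s)=f(s)$ as an output), by evaluating, with $d_i=d_i(s)$ and $r_j=r_j(s)$, the following sum term by term: $$\zeta_f^m(s)=\zeta_f^{m+1}(s)+\sum_{i=m+1}^{n-k}\zeta_f^m\bigl(s*(d_i\to r_{m+1})\bigr)+\sum_{j=m+2}^{n-k}\zeta_f^m\bigl(s*(d_{m+1}\to r_j)\bigr)-\sum_{i,j=m+2}^{n-k}\zeta_f^m\bigl(s*(d_i\to r_{m+1})*(d_{m+1}\to r_j)\bigr).$$ The inputs $f(s)$ and the computed outputs $\zeta_f(s)$ are never discarded. Theorem. There exist infinitely many $n$, and in fact all sufficiently large perfect squares $n$ are among them, such that for every input $f$ and every order of treatment of the elements of equal rank this fast zeta transform stores at least $\frac13 n^{1/4}|R_n|$ complex numbers in memory at some point during its execution. Consequently the $O(n^{1/4}|R_n|)$ memory bound is sharp: for any choice, for each $n$, of an input and of an order of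 treatment, the largest number of complex numbers stored at any point of the execution is $O(n^{1/4}|R_n|)$ but not $o(n^{1/4}|R_n|)$ as $n\to\infty$. -/

import Mathlib

/-- The rook monoid (symmetric inverse semigroup) `R_n`: all injective partial functions from an
`n`-element set to itself. Mathlib's order on `PEquiv` is extension of partial functions. -/
abbrev RookMonoid (n : ℕ) : Type := Fin n ≃. Fin n

namespace RookMonoid

instance instDecidableEqRook (n : ℕ) : DecidableEq (RookMonoid n) := fun s t =>
  decidable_of_iff (∀ a, s a = t a) ⟨fun h => PEquiv.ext h, fun h a => by rw [h]⟩

variable {n : ℕ}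

/-- The rank of `s`: the size of its domain. -/
def rank (s : RookMonoid n) : ℕ := (Finset.univ.filter fun a => (s a).isSome = true).card

/-- The elements `d_1(s) < d_2(s) < ...` outside the domain of `s`, in increasing order. -/
def freeDom (s : RookMonoid n) : List (Fin n) :=
  (List.finRange n).filter fun a => (s a).isNone

/-- The elements `r_1(s) < r_2(s) < ...` outside the range of `s`, in increasing order. -/
def freeRan (s : RookMonoid n) : List (Fin n) :=
  (List.finRange n).filter fun b => (s.symm b).isNone

/-- `s * (d → r)`: the element `s` with `d` added to its domain and sent to `r`. It is only used
for `d` outside the domain and `r` outside the range of `s`, where the clauses that delete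
conflicting pairs do nothing. -/
def extend (s : RookMonoid n) (d r : Fin n) : RookMonoid n where
  toFun a := if a = d then some r else if s a = some r then none else s a
  invFun b := if b = r then some d else if s.symm b = some d then none else s.symm b
  inv a b := by
    have h1 : s.symm b = some a ↔ s a = some b := s.eq_some_iff
    have h2 : s.symm b = some d ↔ s d = some b := s.eq_some_iff
    grind

end RookMonoid

/-! ### A straight-line machine over `ℂ` with an addressable memory -/

/-- A memory whose cells are named by `κ`; each cell is empty or stores one complex number. -/
abbrev Memory (κ : Type) : Type := κ → Option ℂ

/-- Instructions: `dst := src`, `dst := dst + src`, `dst := dst - src`, and emptying a cell. -/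
inductive Instr (κ : Type) : Type
  | copy (dst src : κ)
  | add (dst src : κ)
  | sub (dst src : κ)
  | discard (c : κ)

/-- The effect of one instruction. If an operand is missing from memory, nothing is produced:
the destination cell becomes empty. -/
noncomputable def Instr.exec {κ : Type} [DecidableEq κ] : Instr κ → Memory κ → Memory κ
  | .copy dst src, μ => Function.update μ dst (μ src)
  | .add dst src, μ =>
      Function.update μ dst ((μ dst).bind fun x => (μ src).map fun y => x + y)
  | .sub dst src, μ =>
      Function.update μ dst ((μ dst).bind fun x => (μ src).map fun y => x - y)
  | .discard c, μ => Function.update μ c none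

/-- Run a program, first instruction first. -/
noncomputable def runProgram {κ : Type} [DecidableEq κ] (p : List (Instr κ)) (μ : Memory κ) :
    Memory κ :=
  p.foldl (fun ν i => i.exec ν) μ

/-- The number of complex numbers stored in a memory (finite for every memory that occurs in a
run started from a memory with finitely many occupied cells). -/
noncomputable def storedCount {κ : Type} (μ : Memory κ) : ℕ := {c | μ c ≠ none}.ncard

/-! ### The fast zeta transform on the rook monoid -/

namespace FastZeta

open RookMonoid

/-- The memory cells: the input `f(s)`, the output `ζ_f(s)`, and, for `0 < m < n - rk(s)`, a
temporary cell for `ζ_f(s, {d_1(s), ..., d_m(s)}, {r_1(s), ..., r_m(s)})`. -/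
inductive Cell (n : ℕ) : Type
  | input (s : RookMonoid n)
  | output (s : RookMonoid n)
  | work (s : RookMonoid n) (m : ℕ)
  deriving DecidableEq

variable {n : ℕ}

/-- The cell of the partial zeta transform `ζ_f(s, {d_1(s), ..., d_m(s)}, {r_1(s), ..., r_m(s)})`,
`0 ≤ m ≤ n - rk(s)`. It is the output `ζ_f(s)` for `m = 0` and the input `f(s)` for
`m = n - rk(s)`. -/
def partialCell (s : RookMonoid n) (m : ℕ) : Cell n :=
  if m = 0 then .output s else if m = n - rank s then .input s else .work s m

/-- Compute the `m`-th partial zeta transform at `s`, for `m < n - rk(s)`. Here `d`, `ds` are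
`d_{m+1}(s)` and the list of the `d_i(s)`, `i > m + 1`; similarly `r`, `rs`. -/
def partialProgram (s : RookMonoid n) (m : ℕ) : List (Instr (Cell n)) :=
  match (freeDom s).drop m, (freeRan s).drop m with
  | d :: ds, r :: rs =>
      [.copy (partialCell s m) (partialCell s (m + 1)),
        .add (partialCell s m) (partialCell (s.extend d r) m)]
      ++ ds.map (fun d' => .add (partialCell s m) (partialCell (s.extend d' r) m))
      ++ rs.map (fun r' => .add (partialCell s m) (partialCell (s.extend d r') m))
      ++ ds.flatMap (fun d' => rs.map fun r' =>
          .sub (partialCell s m) (partialCell ((s.extend d' r).extend d r') m))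
  | _, _ => []

/-- Compute all partial zeta transforms at `s`, for `m = n - rk(s) - 1, ..., 1, 0` in this order
(the one for `m = n - rk(s)` is the input `f(s)`). If `rk(s) = n`, then `ζ_f(s) = f(s)`. -/
def elementProgram (s : RookMonoid n) : List (Instr (Cell n)) :=
  if rank s = n then [.copy (.output s) (.input s)]
  else (List.range (n - rank s)).reverse.flatMap (partialProgram s)

/-- Discard the temporary partial zeta transforms at `s`. -/
def discardProgram (s : RookMonoid n) : List (Instr (Cell n)) :=
  (List.range (n - rank s)).map fun m => .discard (.work s m)

/-- Step `n - k`: first discard the temporary numbers that belong to elements of rank `k + 3`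
(those of higher rank are already gone), then compute all partial zeta transforms at the elements
of rank `k`. The list `order` contains all elements of `R_n`. -/
def stepProgram (order : List (RookMonoid n)) (k : ℕ) : List (Instr (Cell n)) :=
  (order.filter fun s => rank s = k + 3).flatMap discardProgram
  ++ (order.filter fun s => rank s = k).flatMap elementProgram

/-- The whole algorithm: steps `0, 1, ..., n`, i.e. ranks `n, n - 1, ..., 0`. -/
def program (order : List (RookMonoid n)) : List (Instr (Cell n)) :=
  (List.range (n + 1)).reverse.flatMap (stepProgram order)

/-- Initially the memory holds exactly the input function `f`. -/
def initialMemory (f : RookMonoid n → ℂ) : Memory (Cell n)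
  | .input s => some (f s)
  | _ => none

/-- `order` lists every element of `R_n` exactly once. -/
def IsEnumeration (order : List (RookMonoid n)) : Prop :=
  order.Nodup ∧ ∀ s : RookMonoid n, s ∈ order

/-- The number of complex numbers in memory after the first `t` instructions of the fast zeta
transform on input `f`, when elements of equal rank are treated in the order given by `order`. -/
noncomputable def memoryUse (order : List (RookMonoid n)) (f : RookMonoid n → ℂ) (t : ℕ) : ℕ :=
  storedCount (runProgram ((program order).take t) (initialMemory f))

/-- The largest number of complex numbers in memory at any point of the execution. -/
noncomputable def peakMemory (order : List (RookMonoid n)) (f : RookMonoid n → ℂ) : ℕ :=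
  (Finset.range ((program order).length + 1)).sup (memoryUse order f)

end FastZeta

/-- `n^{1/4} |R_n|`. -/
noncomputable def rookBound (n : ℕ) : ℝ := (n : ℝ) ^ ((1 : ℝ) / 4) * (Nat.card (RookMonoid n) : ℝ)

/-! Let `a j` be the number of elements of corank `j`. Counting one-point extensions gives `a (j +
1) / a j = (n - j) / (j + 1) ^ 2` (`card_corankLevel_succ`). This ratio crosses 1 near `j = √n` and
at distance `i` from there differs from 1 by order `i / √n`. The sequence is therefore a bump of
width of order `n ^ (1/4)`, and `|R_n|`, the sum of the `a j`, is of order `n ^ (1/4) * a √n`. An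
element of corank `j` owns `j - 1` temporary cells, so a level near the peak costs about `√n * a
√n`, which is of order `n ^ (1/4) * |R_n|`.

Lower bound: when the step of rank `k` ends, every temporary cell of ranks `k`, `k + 1`, `k + 2` is
filled (`subset_occupied_programDownTo`), whatever the input and the order of treatment. For `n = q
^ 2` and `k = n - q` these are three levels around the peak, and `rpow_mul_sum_le` compares their
cost with the whole sum.

Upper bound: at every moment the filled temporary cells belong to at most four consecutive ranks
(`occupied_take_program_subset`), and each level costs at most `16 * n ^ (1/4) * |R_n|`
(`IsCorankSequence.mul_le`). Inputs and outputs add `2 * |R_n|`. -/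

/-! ### Sequences with the ratios of the rank numbers -/

/-- A nonincreasing sequence that from index `L` on decays geometrically with ratio `L / (L + 1)`
has partial sums at most `2 * L + 1` times its first term. -/
theorem sum_range_le_of_geometric_decay {b : ℕ → ℝ} {L : ℕ} (hb : ∀ i, 0 ≤ b i)
    (hanti : ∀ i, b (i + 1) ≤ b i) (hgeo : ∀ i, L ≤ i → (L + 1 : ℝ) * b (i + 1) ≤ L * b i)
    (N : ℕ) : ∑ i ∈ Finset.range N, b i ≤ (2 * L + 1) * b 0 := by
  have hA : Antitone b := antitone_nat_of_succ_le hanti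
  -- The extra term `(L + 1) * b (L + M)` is the sum of a full geometric tail of ratio `L / (L + 1)`
  -- starting at `b (L + M)`; with it the left side cannot increase with `M`.
  have key : ∀ M, ∑ i ∈ Finset.range (L + M), b i + (L + 1) * b (L + M) ≤ (2 * L + 1) * b 0 := by
    intro M
    induction M with
    | zero =>
      have h1 : ∑ i ∈ Finset.range L, b i ≤ L * b 0 := by
        calc ∑ i ∈ Finset.range L, b i ≤ ∑ _i ∈ Finset.range L, b 0 :=
              Finset.sum_le_sum fun i _ => hA (Nat.zero_le i)
          _ = L * b 0 := by simp
      have h2 : (L + 1 : ℝ) * b L ≤ (L + 1) * b 0 :=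
        mul_le_mul_of_nonneg_left (hA (Nat.zero_le L)) (by positivity)
      simp only [add_zero]
      linarith
    | succ M ih =>
      rw [← add_assoc, Finset.sum_range_succ]
      have := hgeo (L + M) (Nat.le_add_right _ _)
      linarith
  calc ∑ i ∈ Finset.range N, b i ≤ ∑ i ∈ Finset.range (L + N), b i :=
        Finset.sum_le_sum_of_subset_of_nonneg
          (Finset.range_mono (Nat.le_add_left _ _)) fun i _ _ => hb i
    _ ≤ _ := by
        have := key N
        have h3 : 0 ≤ (L + 1 : ℝ) * b (L + N) := mul_nonneg (by positivity) (hb _)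
        linarith

/-- A sequence with `a (j + 1) / a j = (n - j) / (j + 1) ^ 2`, as the numbers of elements of
corank `j` of the rook monoid. -/
structure IsCorankSequence (n : ℕ) (a : ℕ → ℝ) : Prop where
  nonneg : ∀ j, 0 ≤ a j
  rel : ∀ j : ℕ, ((j : ℝ) + 1) ^ 2 * a (j + 1) = ((n - j : ℕ) : ℝ) * a j

namespace IsCorankSequence

variable {n : ℕ} {a : ℕ → ℝ}

theorem rel_le (h : IsCorankSequence n a) (j : ℕ) : ((j : ℝ) + 1) ^ 2 * a (j + 1) ≤ n * a j := by
  rw [h.rel]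
  exact mul_le_mul_of_nonneg_right (by exact_mod_cast Nat.sub_le n j) (h.nonneg j)

/-- With real subtraction the bound survives `j > n`, where its left side is nonpositive. -/
theorem le_rel (h : IsCorankSequence n a) (j : ℕ) :
    ((n : ℝ) - j) * a j ≤ ((j : ℝ) + 1) ^ 2 * a (j + 1) := by
  rw [h.rel]
  refine mul_le_mul_of_nonneg_right ?_ (h.nonneg j)
  have : (n : ℝ) ≤ ((n - j : ℕ) : ℝ) + j := by exact_mod_cast (by omega : n ≤ n - j + j)
  linarith

theorem succ_le (h : IsCorankSequence n a) {j : ℕ} (hj : n ≤ (j + 1) ^ 2) : a (j + 1) ≤ a j := by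
  have h1 := h.rel_le j
  have h2 : (n : ℝ) ≤ ((j : ℝ) + 1) ^ 2 := by exact_mod_cast hj
  have h3 : (0 : ℝ) < ((j : ℝ) + 1) ^ 2 := by positivity
  have h4 := mul_le_mul_of_nonneg_right h2 (h.nonneg j)
  exact le_of_mul_le_mul_left (h1.trans h4) h3

/-- With `q = p + 1`, the ratio at `p + i` is at most `(q / (q + i)) ^ 2 ≤ q / (q + i)`, which is at
most `L / (L + 1)` as soon as `i ≥ L`, because `q ≤ L ^ 2`. -/
theorem sum_right_le {p L : ℕ} (h : IsCorankSequence ((p + 1) ^ 2) a) (hL : p + 1 ≤ L ^ 2)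
    (N : ℕ) : ∑ i ∈ Finset.range N, a (p + i) ≤ (2 * L + 1) * a p := by
  refine sum_range_le_of_geometric_decay (b := fun i => a (p + i)) (fun i => h.nonneg _)
    (fun i => h.succ_le (Nat.pow_le_pow_left (Nat.succ_le_succ (Nat.le_add_right p i)) 2))
    (fun i hi => ?_) N
  have h1 := h.rel_le (p + i)
  push_cast at h1
  have hL' : (p : ℝ) + 1 ≤ (L : ℝ) ^ 2 := by exact_mod_cast hL
  have hi' : (L : ℝ) ≤ i := by exact_mod_cast hi
  have ha := h.nonneg (p + i)
  have hp : (0 : ℝ) < (p : ℝ) + 1 := by positivity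
  -- `a (p + i + 1) ≤ (q / (q + i)) * a (p + i)` with `q = p + 1`
  have h2 : ((p : ℝ) + i + 1) * a (p + i + 1) ≤ (p + 1) * a (p + i) := by
    have h3 : ((p : ℝ) + i + 1) * (((p : ℝ) + i + 1) * a (p + i + 1))
        ≤ ((p : ℝ) + i + 1) * ((p + 1) * a (p + i)) := by
      have : ((p : ℝ) + 1) * ((p + 1) * a (p + i)) ≤ ((p : ℝ) + i + 1) * ((p + 1) * a (p + i)) := by
        gcongr; linarith [(Nat.cast_nonneg i : (0 : ℝ) ≤ i)]
      nlinarith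
    exact le_of_mul_le_mul_left h3 (by positivity)
  have h4 : ((p : ℝ) + 1) * (L + 1) ≤ L * (p + i + 1) := by nlinarith [(Nat.cast_nonneg L : (0:ℝ) ≤ L)]
  have h5 : ((p : ℝ) + i + 1) * ((L + 1) * a (p + i + 1)) ≤ ((p : ℝ) + i + 1) * (L * a (p + i)) := by
    calc ((p : ℝ) + i + 1) * ((L + 1) * a (p + i + 1))
        = (L + 1) * (((p : ℝ) + i + 1) * a (p + i + 1)) := by ring
      _ ≤ (L + 1) * ((p + 1) * a (p + i)) := by gcongr
      _ = (((p : ℝ) + 1) * (L + 1)) * a (p + i) := by ring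
      _ ≤ (L * (p + i + 1)) * a (p + i) := by gcongr
      _ = _ := by ring
  exact le_of_mul_le_mul_left h5 (by positivity)

/-- Read backwards from `p` and continued by zero, the sequence has ratio at most `(p - i) / (p +
1)` at distance `i`, which is again at most `L / (L + 1)` for `i ≥ L`. -/
theorem sum_left_le {p L : ℕ} (h : IsCorankSequence ((p + 1) ^ 2) a) (hL : p + 1 ≤ L ^ 2) :
    ∑ j ∈ Finset.range (p + 1), a j ≤ (2 * L + 1) * a p := by
  set b : ℕ → ℝ := fun i => if i ≤ p then a (p - i) else 0 with hb
  have hb0 : b 0 = a p := by simp [hb]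
  have hbn : ∀ i, 0 ≤ b i := by
    intro i
    simp only [hb]
    split_ifs
    · exact h.nonneg _
    · exact le_rfl
  -- `b (i + 1) * (p + 1) ≤ (p - i) * b i`
  have hstep : ∀ i, i ≤ p → ((p : ℝ) + 1) * b (i + 1) ≤ ((p : ℝ) - i) * b i := by
    intro i hip
    rcases hip.eq_or_lt with rfl | hlt
    · simp [hb]
    obtain ⟨m, rfl⟩ : ∃ m, p = m + i + 1 := ⟨p - i - 1, by omega⟩
    have e1 : b (i + 1) = a m := by
      simp only [hb]; rw [if_pos (by omega)]; congr 1; omega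
    have e2 : b i = a (m + 1) := by
      simp only [hb]; rw [if_pos (by omega)]; congr 1; omega
    rw [e1, e2]
    have h1 := h.le_rel m
    push_cast at h1 ⊢
    have hm : (0 : ℝ) ≤ m := by positivity
    have hi : (0 : ℝ) ≤ i := by positivity
    have hcoef : ((m : ℝ) + i + 1) * (m + i + 1 + 1) ≤ (m + i + 1 + 1) ^ 2 - m := by nlinarith
    have h2 : ((m : ℝ) + i + 1) * ((m + i + 1 + 1) * a m)
        ≤ ((m : ℝ) + i + 1) * ((m + i + 1 - i) * a (m + 1)) := by
      calc ((m : ℝ) + i + 1) * ((m + i + 1 + 1) * a m)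
          = (((m : ℝ) + i + 1) * (m + i + 1 + 1)) * a m := by ring
        _ ≤ ((m + i + 1 + 1) ^ 2 - m) * a m := mul_le_mul_of_nonneg_right hcoef (h.nonneg m)
        _ ≤ _ := h1
        _ = ((m : ℝ) + 1) * ((m + 1) * a (m + 1)) := by ring
        _ ≤ ((m : ℝ) + i + 1) * ((m + 1) * a (m + 1)) := by
            have := h.nonneg (m + 1)
            gcongr
            linarith
        _ = _ := by ring
    exact le_of_mul_le_mul_left h2 (by positivity)
  have hgt : ∀ i, ¬ i ≤ p → b (i + 1) = 0 := fun i hi => by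
    simp only [hb]; rw [if_neg (by omega)]
  have hsum := sum_range_le_of_geometric_decay (b := b) (L := L) hbn (fun i => by
      by_cases hip : i ≤ p
      · have h1 := hstep i hip
        have h2 : ((p : ℝ) - i) * b i ≤ (p + 1) * b i :=
          mul_le_mul_of_nonneg_right (by linarith [(Nat.cast_nonneg i : (0 : ℝ) ≤ i)]) (hbn i)
        exact le_of_mul_le_mul_left (h1.trans h2) (by positivity)
      · rw [hgt i hip]; exact hbn i)
    (fun i hi => by
      by_cases hip : i ≤ p
      · have h1 := hstep i hip
        have hL' : (p : ℝ) + 1 ≤ (L : ℝ) ^ 2 := by exact_mod_cast hL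
        have hi' : (L : ℝ) ≤ i := by exact_mod_cast hi
        have hL0 : (0 : ℝ) ≤ L := by positivity
        have h2 : (L + 1 : ℝ) * (p - i) ≤ L * (p + 1) := by nlinarith
        have h3 : ((p : ℝ) + 1) * ((L + 1) * b (i + 1)) ≤ ((p : ℝ) + 1) * (L * b i) := by
          calc ((p : ℝ) + 1) * ((L + 1) * b (i + 1)) = (L + 1) * ((p + 1) * b (i + 1)) := by ring
            _ ≤ (L + 1) * ((p - i) * b i) := by gcongr
            _ = ((L + 1) * (p - i)) * b i := by ring
            _ ≤ (L * (p + 1)) * b i := mul_le_mul_of_nonneg_right h2 (hbn i)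
            _ = _ := by ring
        exact le_of_mul_le_mul_left h3 (by positivity)
      · rw [hgt i hip, mul_zero]; exact mul_nonneg (by positivity) (hbn i)) (p + 1)
  rw [hb0] at hsum
  refine le_trans (le_of_eq ?_) hsum
  rw [← Finset.sum_range_reflect]
  refine Finset.sum_congr rfl fun i hi => ?_
  rw [Finset.mem_range] at hi
  simp only [hb]
  rw [if_pos (by omega)]
  congr 1

/-- If `n = (p + 1) ^ 2`, then the sum of a corank sequence is `O(√(p + 1))` times `a p`. -/
theorem sum_le {p L : ℕ} (h : IsCorankSequence ((p + 1) ^ 2) a) (hL : p + 1 ≤ L ^ 2) (N : ℕ) :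
    ∑ j ∈ Finset.range N, a j ≤ (4 * L + 2) * a p := by
  have h1 := h.sum_left_le hL
  have h2 := h.sum_right_le hL N
  calc ∑ j ∈ Finset.range N, a j ≤ ∑ j ∈ Finset.range (p + N), a j :=
        Finset.sum_le_sum_of_subset_of_nonneg (Finset.range_mono (Nat.le_add_left _ _))
          fun i _ _ => h.nonneg i
    _ = ∑ j ∈ Finset.range p, a j + ∑ i ∈ Finset.range N, a (p + i) := Finset.sum_range_add ..
    _ ≤ ∑ j ∈ Finset.range (p + 1), a j + ∑ i ∈ Finset.range N, a (p + i) := by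
        rw [Finset.sum_range_succ]; linarith [h.nonneg p]
    _ ≤ _ := by linarith

/-- The lower bound for three consecutive weighted terms around the maximum. -/
theorem rpow_mul_sum_le {q : ℕ} (hq : 16 ≤ q) (h : IsCorankSequence (q ^ 2) a) (N : ℕ) :
    (1 / 3 : ℝ) * (((q ^ 2 : ℕ) : ℝ) ^ ((1 : ℝ) / 4) * ∑ j ∈ Finset.range N, a j)
      ≤ ((q : ℝ) - 1) * a q + ((q : ℝ) - 2) * a (q - 1) + ((q : ℝ) - 3) * a (q - 2) := by
  obtain ⟨p, rfl⟩ : ∃ p, q = p + 2 := ⟨q - 2, by omega⟩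
  -- The peak of the sequence for `n = q ^ 2` is at `q - 1`, which is `p + 1` here.
  have hsum := IsCorankSequence.sum_le (p := p + 1) (L := Nat.sqrt (p + 2) + 1) h
    (Nat.lt_succ_sqrt' (p + 2)).le N
  have h1 := h.le_rel (p + 1)
  have h2 := h.rel_le p
  have e1 : p + 2 - 1 = p + 1 := rfl
  have e2 : p + 2 - 2 = p := rfl
  rw [e1, e2]
  have hnn := h.nonneg
  have hA := hnn (p + 1)
  set A := a (p + 1)
  set x : ℝ := Real.sqrt ((p + 2 : ℕ) : ℝ) with hx
  have hxx : x ^ 2 = p + 2 := by rw [hx, Real.sq_sqrt (by positivity)]; push_cast; ring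
  have hx4 : 4 ≤ x := by
    rw [hx]; apply Real.le_sqrt_of_sq_le; norm_num; exact_mod_cast hq
  have hpow : (((p + 2) ^ 2 : ℕ) : ℝ) ^ ((1 : ℝ) / 4) = x := by
    have : (((p + 2) ^ 2 : ℕ) : ℝ) = x ^ (4 : ℝ) := by
      rw [show (4 : ℝ) = ((4 : ℕ) : ℝ) by norm_num, Real.rpow_natCast]
      push_cast
      rw [show x ^ 4 = (x ^ 2) ^ 2 by ring, hxx]
    rw [this, ← Real.rpow_mul (by positivity)]
    norm_num
  have hsqrt : ((Nat.sqrt (p + 2) : ℕ) : ℝ) ≤ x := Real.nat_sqrt_le_real_sqrt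
  have hp : (14 : ℝ) ≤ p := by exact_mod_cast (by omega : 14 ≤ p)
  rw [hpow]
  have hS : ∑ j ∈ Finset.range N, a j ≤ (4 * x + 6) * A := by
    refine hsum.trans (mul_le_mul_of_nonneg_right ?_ hA)
    push_cast
    linarith
  have hq1 : 2 / 3 * A ≤ a (p + 2) := by
    push_cast at h1
    have : ((p : ℝ) + 1 + 1) ^ 2 * (2 / 3 * A) ≤ ((p : ℝ) + 1 + 1) ^ 2 * a (p + 1 + 1) := by
      refine le_trans ?_ h1
      rw [← mul_assoc]
      exact mul_le_mul_of_nonneg_right (by nlinarith) hA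
    exact le_of_mul_le_mul_left this (by positivity)
  have hq2 : 2 / 3 * A ≤ a p := by
    push_cast at h2
    have : ((p : ℝ) + 2) ^ 2 * (2 / 3 * A) ≤ ((p : ℝ) + 2) ^ 2 * a p := by
      refine le_trans ?_ h2
      rw [← mul_assoc]
      exact mul_le_mul_of_nonneg_right (by nlinarith) hA
    exact le_of_mul_le_mul_left this (by positivity)
  -- The factor `7 / 3` is `1 + 2 / 3 + 2 / 3`, from the peak and its two neighbours, all three
  -- weights being at least `p - 1`. Since `p - 1 = x ^ 2 - 3`, the inequality reduces to `x ^ 2 - 2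
  -- * x - 7 ≥ 0`, which holds from `x = 4`, that is `q = 16`, on.
  have hmain : 1 / 3 * (x * ((4 * x + 6) * A)) ≤ (7 / 3 * ((p : ℝ) - 1)) * A := by
    rw [show 1 / 3 * (x * ((4 * x + 6) * A)) = (1 / 3 * (x * (4 * x + 6))) * A by ring]
    exact mul_le_mul_of_nonneg_right (by nlinarith) hA
  have hS' : 1 / 3 * (x * ∑ j ∈ Finset.range N, a j) ≤ 1 / 3 * (x * ((4 * x + 6) * A)) := by gcongr
  refine (hS'.trans hmain).trans ?_
  push_cast
  have t1 : ((p : ℝ) - 1) * (2 / 3 * A) ≤ ((p : ℝ) - 1) * a (p + 2) :=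
    mul_le_mul_of_nonneg_left hq1 (by linarith)
  have t2 : ((p : ℝ) - 1) * (2 / 3 * A) ≤ ((p : ℝ) - 1) * a p :=
    mul_le_mul_of_nonneg_left hq2 (by linarith)
  have t3 := hnn (p + 2)
  nlinarith

/-- Up to index `√n + L` each step multiplies the sequence by at least `1 - 5 * L / √n`; by
Bernoulli's inequality, `L` steps lose at most the fraction `5 * L ^ 2 / √n ≤ 1 / 2`. -/
theorem half_le {L j i : ℕ} (h : IsCorankSequence n a) (hL : 10 * L ^ 2 ≤ Nat.sqrt n)
    (hL1 : 1 ≤ L) (hj : j ≤ Nat.sqrt n) (hi : i ≤ L) : a j / 2 ≤ a (j + i) := by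
  set s := Nat.sqrt n with hs
  have hsn : (s : ℝ) ^ 2 ≤ n := by exact_mod_cast Nat.sqrt_le' n
  have hL' : 10 * (L : ℝ) ^ 2 ≤ s := by exact_mod_cast hL
  have hL1' : (1 : ℝ) ≤ L := by exact_mod_cast hL1
  have hj' : (j : ℝ) ≤ s := by exact_mod_cast hj
  have hs0 : (0 : ℝ) < s := by nlinarith
  have hLs : (L : ℝ) ≤ s := by nlinarith
  set e : ℝ := 5 * L / s with he
  have hes : e * s = 5 * L := by rw [he]; field_simp
  have he0 : 0 ≤ e := by positivity
  have hLe : L * e ≤ 1 / 2 := by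
    rw [he, mul_div_assoc', div_le_iff₀ hs0]; nlinarith
  have he1 : e ≤ 1 / 2 := by nlinarith
  have key : ∀ i, i ≤ L → (1 - i * e) * a j ≤ a (j + i) := by
    intro i
    induction i with
    | zero => intro _; simp
    | succ i ih =>
      intro hi
      have ih := ih (by omega)
      have h1 := h.le_rel (j + i)
      push_cast at h1 ⊢
      have hi' : (i : ℝ) + 1 ≤ L := by exact_mod_cast hi
      have hup : ((j : ℝ) + i + 1) ^ 2 ≤ (s + L) ^ 2 := by
        apply pow_le_pow_left₀ (by positivity); linarith
      have hcoef : (1 - e) * ((j : ℝ) + i + 1) ^ 2 ≤ n - (j + i) := by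
        have : (1 - e) * ((j : ℝ) + i + 1) ^ 2 ≤ (1 - e) * (s + L) ^ 2 :=
          mul_le_mul_of_nonneg_left hup (by linarith)
        have h2 : e * (s + L) ^ 2 ≥ 5 * L * s := by
          have : e * (s + L) ^ 2 ≥ e * s ^ 2 := by gcongr; linarith
          have : e * s ^ 2 = 5 * L * s := by rw [← hes]; ring
          linarith
        nlinarith
      have h3 : ((j : ℝ) + i + 1) ^ 2 * ((1 - e) * a (j + i))
          ≤ ((j : ℝ) + i + 1) ^ 2 * a (j + i + 1) := by
        refine le_trans ?_ h1
        rw [← mul_assoc, mul_comm _ (1 - e)]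
        exact mul_le_mul_of_nonneg_right hcoef (h.nonneg _)
      have h4 : (1 - e) * a (j + i) ≤ a (j + i + 1) := le_of_mul_le_mul_left h3 (by positivity)
      have h5 : (1 - e) * ((1 - i * e) * a j) ≤ (1 - e) * a (j + i) :=
        mul_le_mul_of_nonneg_left ih (by linarith)
      have h6 : (1 - (i + 1) * e) * a j ≤ (1 - e) * ((1 - i * e) * a j) := by
        rw [← mul_assoc]
        refine mul_le_mul_of_nonneg_right ?_ (h.nonneg j)
        have : 0 ≤ (i : ℝ) * e * e := by positivity
        nlinarith
      exact h6.trans (h5.trans h4)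
  have hi' : (i : ℝ) ≤ L := by exact_mod_cast hi
  have h1 := key i hi
  have h2 : (i : ℝ) * e ≤ L * e := by gcongr
  have h3 : 1 / 2 * a j ≤ (1 - i * e) * a j :=
    mul_le_mul_of_nonneg_right (by linarith) (h.nonneg j)
  linarith

/-- The `L` terms from `a j` on are all at least `a j / 2`, and `L` may be taken as large as `n ^
(1/4) / 8`; hence the constant `16 = 8 * 2`. -/
theorem rpow_mul_le_of_le_sqrt {j : ℕ} (hn : 100 ≤ n) (h : IsCorankSequence n a)
    (hj : j ≤ Nat.sqrt n) :
    (n : ℝ) ^ ((1 : ℝ) / 4) * a j ≤ 16 * ∑ j ∈ Finset.range (n + 1), a j := by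
  set s := Nat.sqrt n with hs
  set L := Nat.sqrt (s / 10) with hLdef
  have hs10 : 10 ≤ s := by rw [hs, Nat.le_sqrt]; omega
  have hL1 : 1 ≤ L := by rw [hLdef, Nat.le_sqrt]; omega
  have hLs : 10 * L ^ 2 ≤ s := by
    have : L ^ 2 ≤ s / 10 := Nat.sqrt_le' (s / 10)
    omega
  have hsL : s + 1 ≤ 10 * (L + 1) ^ 2 := by
    have : s / 10 < (L + 1) ^ 2 := Nat.lt_succ_sqrt' (s / 10)
    omega
  have hns : n < (s + 1) ^ 2 := Nat.lt_succ_sqrt' n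
  have hsn : s ^ 2 ≤ n := Nat.sqrt_le' n
  have hpow : (n : ℝ) ^ ((1 : ℝ) / 4) ≤ 8 * L := by
    have h1 : (n : ℝ) ≤ (8 * L : ℝ) ^ (4 : ℝ) := by
      rw [show (4 : ℝ) = ((4 : ℕ) : ℝ) by norm_num, Real.rpow_natCast]
      have h2 : s + 1 ≤ 40 * L ^ 2 := by nlinarith
      have h3 : n ≤ (8 * L) ^ 4 := by
        calc n ≤ (s + 1) ^ 2 := hns.le
          _ ≤ (40 * L ^ 2) ^ 2 := Nat.pow_le_pow_left h2 2
          _ = 1600 * L ^ 4 := by ring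
          _ ≤ 4096 * L ^ 4 := Nat.mul_le_mul_right _ (by norm_num)
          _ = _ := by ring
      exact_mod_cast h3
    calc (n : ℝ) ^ ((1 : ℝ) / 4) ≤ ((8 * L : ℝ) ^ (4 : ℝ)) ^ ((1 : ℝ) / 4) :=
          Real.rpow_le_rpow (by positivity) h1 (by norm_num)
      _ = 8 * L := by rw [← Real.rpow_mul (by positivity)]; norm_num
  have hsum : L * (a j / 2) ≤ ∑ j ∈ Finset.range (n + 1), a j := by
    calc L * (a j / 2) = ∑ _i ∈ Finset.range L, a j / 2 := by simp
      _ ≤ ∑ i ∈ Finset.range L, a (j + i) := Finset.sum_le_sum fun i hi =>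
          h.half_le hLs hL1 hj (Finset.mem_range.mp hi).le
      _ ≤ ∑ i ∈ Finset.range j, a i + ∑ i ∈ Finset.range L, a (j + i) :=
          le_add_of_nonneg_left (Finset.sum_nonneg fun i _ => h.nonneg i)
      _ = ∑ i ∈ Finset.range (j + L), a i := (Finset.sum_range_add ..).symm
      _ ≤ _ := Finset.sum_le_sum_of_subset_of_nonneg
          (Finset.range_mono (by nlinarith)) fun i _ _ => h.nonneg i
  calc (n : ℝ) ^ ((1 : ℝ) / 4) * a j ≤ 8 * L * a j :=
        mul_le_mul_of_nonneg_right hpow (h.nonneg j)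
    _ = 16 * (L * (a j / 2)) := by ring
    _ ≤ _ := by gcongr

/-- Beyond `√n` the sequence is nonincreasing, so the bound at `√n` carries over. -/
theorem rpow_mul_le (hn : 100 ≤ n) (h : IsCorankSequence n a) (j : ℕ) :
    (n : ℝ) ^ ((1 : ℝ) / 4) * a j ≤ 16 * ∑ j ∈ Finset.range (n + 1), a j := by
  rcases le_total j (Nat.sqrt n) with hj | hj
  · exact h.rpow_mul_le_of_le_sqrt hn hj
  · refine le_trans ?_ (h.rpow_mul_le_of_le_sqrt hn le_rfl)
    refine mul_le_mul_of_nonneg_left ?_ (by positivity)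
    induction j, hj using Nat.le_induction with
    | base => exact le_rfl
    | succ j hj ih =>
      refine (h.succ_le ?_).trans ih
      exact (Nat.lt_succ_sqrt' n).le.trans (Nat.pow_le_pow_left (by omega) 2)

/-- The terms weighted by the corank are `O(n ^ (1 / 4))` times the sum. -/
theorem mul_le (hn : 100 ≤ n) (h : IsCorankSequence n a) (j : ℕ) :
    j * a j ≤ 16 * ((n : ℝ) ^ ((1 : ℝ) / 4) * ∑ j ∈ Finset.range (n + 1), a j) := by
  set x : ℝ := (n : ℝ) ^ ((1 : ℝ) / 4) with hx
  have hn0 : (0 : ℝ) < n := by exact_mod_cast (by omega : 0 < n)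
  have hx0 : 0 < x := Real.rpow_pos_of_pos hn0 _
  have hx4 : x ^ 4 = n := by
    rw [hx, ← Real.rpow_natCast, ← Real.rpow_mul hn0.le]; norm_num
  -- Here `x ^ 2 = √n`. For larger `j` the recursion trades the weight for a shift: `j * a j ≤ (n /
  -- j) * a (j - 1) ≤ √n * a (j - 1)`.
  have hmax : ∃ i, j * a j ≤ x ^ 2 * a i := by
    by_cases hj : (j : ℝ) ≤ x ^ 2
    · exact ⟨j, mul_le_mul_of_nonneg_right hj (h.nonneg j)⟩
    · push Not at hj
      obtain ⟨i, rfl⟩ : ∃ i, j = i + 1 :=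
        ⟨j - 1, by
          have : (0 : ℝ) < j := lt_trans (by positivity) hj
          have : 0 < j := by exact_mod_cast this
          omega⟩
      refine ⟨i, ?_⟩
      have h1 := h.rel_le i
      push_cast at hj ⊢
      have h2 : x ^ 2 * (((i : ℝ) + 1) * a (i + 1)) ≤ x ^ 2 * (x ^ 2 * a i) := by
        calc x ^ 2 * (((i : ℝ) + 1) * a (i + 1)) ≤ (i + 1) * (((i : ℝ) + 1) * a (i + 1)) :=
              mul_le_mul_of_nonneg_right hj.le (mul_nonneg (by positivity) (h.nonneg _))
          _ = ((i : ℝ) + 1) ^ 2 * a (i + 1) := by ring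
          _ ≤ n * a i := h1
          _ = _ := by rw [← hx4]; ring
      exact le_of_mul_le_mul_left h2 (by positivity)
  obtain ⟨i, hi⟩ := hmax
  calc j * a j ≤ x * (x * a i) := by rw [← mul_assoc, ← pow_two]; exact hi
    _ ≤ x * (16 * ∑ j ∈ Finset.range (n + 1), a j) := by
        exact mul_le_mul_of_nonneg_left (h.rpow_mul_le hn i) hx0.le
    _ = _ := by ring

end IsCorankSequence

/-! ### Ranks in the rook monoid -/

namespace RookMonoid

variable {n : ℕ}

instance instFiniteRook (n : ℕ) : Finite (RookMonoid n) :=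
  Finite.of_injective (fun s : RookMonoid n => fun a => s a) fun _ _ h => PEquiv.ext (congrFun h)

noncomputable instance instFintypeRook (n : ℕ) : Fintype (RookMonoid n) := Fintype.ofFinite _

theorem rank_le (s : RookMonoid n) : rank s ≤ n := by
  simpa [rank] using Finset.card_le_univ (Finset.univ.filter fun a => (s a).isSome = true)

theorem card_graph (s : RookMonoid n) :
    (Finset.univ.filter fun x : Fin n × Fin n => s x.1 = some x.2).card = rank s := by
  refine Finset.card_nbij Prod.fst ?_ ?_ ?_
  · intro x hx
    simp only [Finset.mem_univ, true_and, Finset.coe_filter, Set.mem_ofPred_eq] at hx ⊢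
    simp [hx]
  · rintro ⟨a, b⟩ hx ⟨a', b'⟩ hy (rfl : a = a')
    simp only [Finset.coe_filter, Finset.mem_univ, true_and, Set.mem_ofPred_eq] at hx hy
    rw [hx] at hy
    rw [Option.some.inj hy]
  · intro a ha
    simp only [Finset.coe_filter, Finset.mem_univ, true_and, Set.mem_ofPred_eq] at ha
    obtain ⟨b, hb⟩ := Option.isSome_iff_exists.mp ha
    exact ⟨(a, b), by simpa using hb, rfl⟩

theorem rank_symm (s : RookMonoid n) : rank s.symm = rank s := by
  rw [← card_graph, ← card_graph]
  refine Finset.card_equiv (Equiv.prodComm _ _) fun x => ?_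
  simp only [Finset.mem_filter, Finset.mem_univ, true_and, Equiv.prodComm_apply, Prod.fst_swap,
    Prod.snd_swap]
  exact s.eq_some_iff

theorem card_isNone (s : RookMonoid n) :
    (Finset.univ.filter fun a => s a = none).card = n - rank s := by
  have h := Finset.card_filter_add_card_filter_not (s := (Finset.univ : Finset (Fin n)))
    (fun a => (s a).isSome = true)
  simp only [Bool.not_eq_true, Option.isSome_eq_false_iff, Option.isNone_iff_eq_none,
    Finset.card_univ, Fintype.card_fin] at h
  rw [rank]
  omega

theorem mem_freeDom {s : RookMonoid n} {a : Fin n} : a ∈ freeDom s ↔ s a = none := by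
  simp [freeDom]

theorem mem_freeRan {s : RookMonoid n} {b : Fin n} : b ∈ freeRan s ↔ s.symm b = none := by
  simp [freeRan]

theorem nodup_freeDom (s : RookMonoid n) : (freeDom s).Nodup := (List.nodup_finRange n).filter _

theorem nodup_freeRan (s : RookMonoid n) : (freeRan s).Nodup := (List.nodup_finRange n).filter _

theorem length_freeDom (s : RookMonoid n) : (freeDom s).length = n - rank s := by
  rw [← card_isNone, ← List.toFinset_card_of_nodup (nodup_freeDom s)]
  congr 1
  ext a
  simp [mem_freeDom]

theorem length_freeRan (s : RookMonoid n) : (freeRan s).length = n - rank s := by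
  rw [← rank_symm, ← length_freeDom]
  rfl

theorem extend_apply {s : RookMonoid n} {d r : Fin n} (hr : s.symm r = none) (a : Fin n) :
    s.extend d r a = if a = d then some r else s a := by
  have h : s a ≠ some r := fun h => by
    rw [s.eq_some_iff.mpr h] at hr
    cases hr
  change (if a = d then some r else if s a = some r then none else s a) = _
  rw [if_neg h]

theorem extend_symm_apply {s : RookMonoid n} {d r : Fin n} (hd : s d = none) (b : Fin n) :
    (s.extend d r).symm b = if b = r then some d else s.symm b := by
  have h : s.symm b ≠ some d := fun h => by
    rw [s.eq_some_iff.mp h] at hd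
    cases hd
  change (if b = r then some d else if s.symm b = some d then none else s.symm b) = _
  rw [if_neg h]

theorem rank_extend {s : RookMonoid n} {d r : Fin n} (hd : s d = none) (hr : s.symm r = none) :
    rank (s.extend d r) = rank s + 1 := by
  rw [rank, rank, ← Finset.card_insert_of_notMem (a := d) (by simp [hd])]
  congr 1
  ext a
  simp only [extend_apply hr, Finset.mem_filter, Finset.mem_univ, true_and, Finset.mem_insert]
  by_cases h : a = d <;> simp [h]

/-- The element `t` with `d` removed from its domain. -/
def erase (t : RookMonoid n) (d : Fin n) : RookMonoid n where
  toFun a := if a = d then none else t a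
  invFun b := if t.symm b = some d then none else t.symm b
  inv a b := by
    have h1 : t.symm b = some a ↔ t a = some b := t.eq_some_iff
    have h2 : t.symm b = some d ↔ t d = some b := t.eq_some_iff
    grind

theorem erase_apply (t : RookMonoid n) (d a : Fin n) :
    t.erase d a = if a = d then none else t a := rfl

theorem erase_symm_apply (t : RookMonoid n) (d b : Fin n) :
    (t.erase d).symm b = if t.symm b = some d then none else t.symm b := rfl

theorem erase_extend {s : RookMonoid n} {d r : Fin n} (hd : s d = none) (hr : s.symm r = none) :
    (s.extend d r).erase d = s := by
  refine PEquiv.ext fun a => ?_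
  rw [erase_apply, extend_apply hr]
  by_cases h : a = d <;> simp [h, hd]

theorem extend_erase {t : RookMonoid n} {d r : Fin n} (h : t d = some r) :
    (t.erase d).extend d r = t := by
  have hr : (t.erase d).symm r = none := by
    rw [erase_symm_apply, t.eq_some_iff.mpr h, if_pos rfl]
  refine PEquiv.ext fun a => ?_
  rw [extend_apply hr, erase_apply]
  by_cases h' : a = d <;> simp [h', h]

variable (n) in
/-- The elements of corank `j`. -/
noncomputable def corankLevel (j : ℕ) : Finset (RookMonoid n) :=
  Finset.univ.filter fun s => rank s + j = n

theorem mem_corankLevel {j : ℕ} {s : RookMonoid n} : s ∈ corankLevel n j ↔ rank s + j = n := by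
  simp [corankLevel]

/-- Both sides count the ways to extend an element of corank `j + 1` to one of corank `j`. -/
theorem card_corankLevel_succ (j : ℕ) :
    (j + 1) ^ 2 * (corankLevel n (j + 1)).card = (n - j) * (corankLevel n j).card := by
  have hA : ((corankLevel n (j + 1)).sigma fun s =>
      (Finset.univ.filter fun a => s a = none) ×ˢ
        (Finset.univ.filter fun b => s.symm b = none)).card
      = (j + 1) ^ 2 * (corankLevel n (j + 1)).card := by
    rw [Finset.card_sigma, Finset.sum_const_nat (m := (j + 1) ^ 2), mul_comm]
    intro s hs
    rw [mem_corankLevel] at hs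
    rw [Finset.card_product, card_isNone, card_isNone, rank_symm, pow_two]
    congr 1 <;> omega
  have hB : ((corankLevel n j).sigma fun t =>
      Finset.univ.filter fun x : Fin n × Fin n => t x.1 = some x.2).card
      = (n - j) * (corankLevel n j).card := by
    rw [Finset.card_sigma, Finset.sum_const_nat (m := n - j), mul_comm]
    intro t ht
    rw [mem_corankLevel] at ht
    rw [card_graph]
    omega
  rw [← hA, ← hB]
  -- The added pair is carried along, which makes extension invertible by `erase`.
  refine Finset.card_bij' (fun x _ => ⟨x.1.extend x.2.1 x.2.2, x.2⟩)
    (fun x _ => ⟨x.1.erase x.2.1, x.2⟩) ?_ ?_ ?_ ?_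
  · rintro ⟨s, d, r⟩ h
    simp only [Finset.mem_sigma, mem_corankLevel, Finset.mem_product, Finset.mem_filter,
      Finset.mem_univ, true_and] at h ⊢
    obtain ⟨h1, hd, hr⟩ := h
    rw [rank_extend hd hr, extend_apply hr]
    simp; omega
  · rintro ⟨t, d, r⟩ h
    simp only [Finset.mem_sigma, mem_corankLevel, Finset.mem_product, Finset.mem_filter,
      Finset.mem_univ, true_and] at h ⊢
    obtain ⟨h1, h2⟩ := h
    have hd : t.erase d d = none := by rw [erase_apply, if_pos rfl]
    have hr : (t.erase d).symm r = none := by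
      rw [erase_symm_apply, t.eq_some_iff.mpr h2, if_pos rfl]
    have := rank_extend hd hr
    rw [extend_erase h2] at this
    exact ⟨by omega, hd, hr⟩
  · rintro ⟨s, d, r⟩ h
    simp only [Finset.mem_sigma, mem_corankLevel, Finset.mem_product, Finset.mem_filter,
      Finset.mem_univ, true_and] at h
    simp [erase_extend h.2.1 h.2.2]
  · rintro ⟨t, d, r⟩ h
    simp only [Finset.mem_sigma, mem_corankLevel, Finset.mem_filter,
      Finset.mem_univ, true_and] at h
    simp [extend_erase h.2]

theorem sum_card_corankLevel :
    ∑ j ∈ Finset.range (n + 1), (corankLevel n j).card = Nat.card (RookMonoid n) := by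
  rw [Nat.card_eq_fintype_card, ← Finset.card_univ,
    Finset.card_eq_sum_card_fiberwise (f := fun s : RookMonoid n => n - rank s)
      (t := Finset.range (n + 1)) (fun s _ => by simp)]
  refine Finset.sum_congr rfl fun j hj => ?_
  congr 1
  ext s
  have := rank_le s
  rw [Finset.mem_range] at hj
  simp only [mem_corankLevel, Finset.mem_filter, Finset.mem_univ, true_and]
  omega

/-- A sum over the elements of corank in `J` of a function of the corank. -/
theorem sum_filter_corank (J : Finset ℕ) (g : ℕ → ℕ) :
    ∑ s ∈ Finset.univ.filter (fun s : RookMonoid n => n - rank s ∈ J), g (n - rank s)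
      = ∑ j ∈ J, if j ≤ n then (corankLevel n j).card * g j else 0 := by
  rw [← Finset.sum_fiberwise_of_maps_to (g := fun s : RookMonoid n => n - rank s) (t := J)
    (fun s hs => (Finset.mem_filter.mp hs).2)]
  refine Finset.sum_congr rfl fun j hj => ?_
  rw [Finset.sum_congr rfl (g := fun _ => g j) fun s hs => by rw [(Finset.mem_filter.mp hs).2],
    Finset.sum_const, smul_eq_mul]
  have e : ∀ s : RookMonoid n, s ∈ (Finset.univ.filter
      fun s : RookMonoid n => n - rank s ∈ J).filter (fun s => n - rank s = j) ↔
      n - rank s = j := by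
    intro s
    simp only [Finset.mem_filter, Finset.mem_univ, true_and]
    exact ⟨fun h => h.2, fun h => ⟨h ▸ hj, h⟩⟩
  split_ifs with hjn
  · congr 2
    ext s
    have := rank_le s
    rw [e, mem_corankLevel]
    omega
  · rw [Finset.card_eq_zero.mpr, zero_mul]
    refine Finset.eq_empty_of_forall_notMem fun s hs => ?_
    rw [e] at hs
    omega

end RookMonoid

/-! ### Which cells are occupied during a run -/

section Support

variable {κ : Type}

/-- The occupied cells of a memory. -/
def occupied (μ : Memory κ) : Set κ := {c | μ c ≠ none}

theorem mem_occupied {μ : Memory κ} {c : κ} : c ∈ occupied μ ↔ μ c ≠ none := Iff.rfl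

variable [DecidableEq κ]

theorem runProgram_append (p q : List (Instr κ)) (μ : Memory κ) :
    runProgram (p ++ q) μ = runProgram q (runProgram p μ) := List.foldl_append

theorem runProgram_cons (i : Instr κ) (p : List (Instr κ)) (μ : Memory κ) :
    runProgram (i :: p) μ = runProgram p (i.exec μ) := rfl

/-- Only `copy` can fill an empty cell: `add` and `sub` need their destination already filled. -/
theorem occupied_runProgram_subset {S : Set κ} {p : List (Instr κ)}
    (hp : ∀ dst src, Instr.copy dst src ∈ p → dst ∈ S) {μ : Memory κ} (hμ : occupied μ ⊆ S) :
    occupied (runProgram p μ) ⊆ S := by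
  induction p generalizing μ with
  | nil => exact hμ
  | cons i p ih =>
    rw [runProgram_cons]
    refine ih (fun dst src h => hp dst src (List.mem_cons_of_mem _ h)) fun c hc => ?_
    rw [mem_occupied] at hc
    by_cases hμc : μ c = none
    · cases i with
      | copy dst src =>
        by_cases h : c = dst
        · exact h ▸ hp dst src List.mem_cons_self
        · rw [Instr.exec, Function.update_of_ne h] at hc
          exact absurd hμc hc
      | add dst src =>
        by_cases h : c = dst
        · subst h; simp [Instr.exec, hμc] at hc
        · rw [Instr.exec, Function.update_of_ne h] at hc
          exact absurd hμc hc
      | sub dst src =>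
        by_cases h : c = dst
        · subst h; simp [Instr.exec, hμc] at hc
        · rw [Instr.exec, Function.update_of_ne h] at hc
          exact absurd hμc hc
      | discard d =>
        by_cases h : c = d
        · subst h; simp [Instr.exec] at hc
        · rw [Instr.exec, Function.update_of_ne h] at hc
          exact absurd hμc hc
    · exact hμ hμc

/-- The instruction leaves all cells of `T` occupied if they are occupied. -/
def Instr.Keeps (T : Set κ) : Instr κ → Prop
  | .copy _ src => src ∈ T
  | .add _ src => src ∈ T
  | .sub _ src => src ∈ T
  | .discard c => c ∉ T

/-- A cell of `T` may be overwritten, but the operands are present, so it receives a number again.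
-/
theorem Instr.Keeps.subset_occupied {T : Set κ} {i : Instr κ} (hi : i.Keeps T) {μ : Memory κ}
    (hμ : T ⊆ occupied μ) : T ⊆ occupied (i.exec μ) := by
  intro c hc
  have h1 : μ c ≠ none := hμ hc
  rw [mem_occupied]
  obtain ⟨x, hx⟩ := Option.ne_none_iff_exists'.mp h1
  cases i with
  | copy dst src =>
    have h2 : μ src ≠ none := hμ hi
    by_cases h : c = dst
    · subst h; simpa [Instr.exec] using h2
    · rwa [Instr.exec, Function.update_of_ne h]
  | add dst src =>
    obtain ⟨y, hy⟩ := Option.ne_none_iff_exists'.mp (hμ hi : μ src ≠ none)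
    by_cases h : c = dst
    · subst h; simp [Instr.exec, hx, hy]
    · rwa [Instr.exec, Function.update_of_ne h]
  | sub dst src =>
    obtain ⟨y, hy⟩ := Option.ne_none_iff_exists'.mp (hμ hi : μ src ≠ none)
    by_cases h : c = dst
    · subst h; simp [Instr.exec, hx, hy]
    · rwa [Instr.exec, Function.update_of_ne h]
  | discard d =>
    have h : c ≠ d := fun h => hi (h ▸ hc)
    rwa [Instr.exec, Function.update_of_ne h]

theorem subset_occupied_runProgram {T : Set κ} {p : List (Instr κ)} (hp : ∀ i ∈ p, i.Keeps T)
    {μ : Memory κ} (hμ : T ⊆ occupied μ) : T ⊆ occupied (runProgram p μ) := by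
  induction p generalizing μ with
  | nil => exact hμ
  | cons i p ih =>
    rw [runProgram_cons]
    exact ih (fun j hj => hp j (List.mem_cons_of_mem _ hj))
      ((hp i List.mem_cons_self).subset_occupied hμ)

theorem subset_occupied_copy {T : Set κ} {μ : Memory κ} (hμ : T ⊆ occupied μ) {dst src : κ}
    (hsrc : src ∈ T) : insert dst T ⊆ occupied ((Instr.copy dst src).exec μ) := by
  rintro c (rfl | hc)
  · have : μ src ≠ none := hμ hsrc
    simpa [mem_occupied, Instr.exec] using this
  · exact Instr.Keeps.subset_occupied (T := T) (i := .copy dst src) hsrc hμ hc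

theorem notMem_occupied_of_discard {p : List (Instr κ)} (hp : ∀ i ∈ p, ∃ c, i = .discard c)
    {c : κ} (hc : Instr.discard c ∈ p) (μ : Memory κ) : c ∉ occupied (runProgram p μ) := by
  obtain ⟨p₁, p₂, rfl⟩ := List.append_of_mem hc
  rw [runProgram_append, runProgram_cons]
  refine fun h => occupied_runProgram_subset (S := {x | x ≠ c}) (fun dst src h' => ?_) ?_ h rfl
  · obtain ⟨_, h''⟩ := hp _ (List.mem_append_right _ (List.mem_cons_of_mem _ h'))
    cases h''
  · rintro x hx rfl
    simp [mem_occupied, Instr.exec] at hx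

/-- `B` holds the operands that every block needs. Quantifying over all `T ⊇ B` lets the cells
filled by earlier blocks accumulate, in any order of the list. -/
theorem subset_occupied_flatMap {β : Type*} {B : Set κ} {cells : β → Set κ}
    {prog : β → List (Instr κ)} {l : List β}
    (h : ∀ x ∈ l, ∀ T : Set κ, B ⊆ T → ∀ μ, T ⊆ occupied μ →
      T ∪ cells x ⊆ occupied (runProgram (prog x) μ)) {T : Set κ} (hT : B ⊆ T) {μ : Memory κ}
    (hμ : T ⊆ occupied μ) :
    T ∪ {c | ∃ x ∈ l, c ∈ cells x} ⊆ occupied (runProgram (l.flatMap prog) μ) := by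
  induction l generalizing T μ with
  | nil => simpa [runProgram] using hμ
  | cons x l ih =>
    rw [List.flatMap_cons, runProgram_append]
    have h1 := ih (fun y hy => h y (List.mem_cons_of_mem _ hy)) (T := T ∪ cells x)
      (hT.trans Set.subset_union_left) (h x List.mem_cons_self T hT μ hμ)
    refine Set.Subset.trans ?_ h1
    rintro c (hc | ⟨y, hy, hc⟩)
    · exact Or.inl (Or.inl hc)
    · rcases List.mem_cons.mp hy with rfl | hy
      · exact Or.inl (Or.inr hc)
      · exact Or.inr ⟨y, hy, hc⟩

end Support

namespace FastZeta

open RookMonoid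

variable {n : ℕ}

/-! #### Lower bound for the set of occupied cells -/

/-- All cells of the partial zeta transforms at the elements with rank in `I`, and the inputs. -/
def fullCells (n : ℕ) (I : Set ℕ) : Set (Cell n) :=
  Set.range Cell.input ∪ {c | ∃ s m, rank s ∈ I ∧ m ≤ n - rank s ∧ c = partialCell s m}

theorem partialCell_mem_fullCells {I : Set ℕ} {s : RookMonoid n} {m : ℕ} (hs : rank s ∈ I)
    (hm : m ≤ n - rank s) : partialCell s m ∈ fullCells n I := Or.inr ⟨s, m, hs, hm, rfl⟩

/-- The operands lie at `s` with index `m + 1` and at extensions of rank one or two higher with the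
same `m`. The initial `copy` fills the destination; the later instructions only need their sources
to be present. -/
theorem subset_occupied_partialProgram {s : RookMonoid n} {m : ℕ} (hm : m < n - rank s)
    {T : Set (Cell n)} (hT : fullCells n (Set.Ioc (rank s) (rank s + 2)) ⊆ T)
    (hsm : partialCell s (m + 1) ∈ T) {μ : Memory (Cell n)} (hμ : T ⊆ occupied μ) :
    insert (partialCell s m) T ⊆ occupied (runProgram (partialProgram s m) μ) := by
  have hld := length_freeDom s
  have hlr := length_freeRan s
  rw [partialProgram]
  rcases hd : (freeDom s).drop m with _ | ⟨d, ds⟩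
  · have := congrArg List.length hd
    simp at this
    omega
  rcases hr : (freeRan s).drop m with _ | ⟨r, rs⟩
  · have := congrArg List.length hr
    simp at this
    omega
  have hdl := congrArg List.length hd
  have hrl := congrArg List.length hr
  simp only [List.length_drop, List.length_cons] at hdl hrl
  have hdfree : ∀ a ∈ d :: ds, s a = none := fun a ha =>
    mem_freeDom.mp (List.mem_of_mem_drop (hd ▸ ha))
  have hrfree : ∀ b ∈ r :: rs, s.symm b = none := fun b hb =>
    mem_freeRan.mp (List.mem_of_mem_drop (hr ▸ hb))
  have hdn : (d :: ds).Nodup := hd ▸ (nodup_freeDom s).sublist (List.drop_sublist _ _)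
  have hrn : (r :: rs).Nodup := hr ▸ (nodup_freeRan s).sublist (List.drop_sublist _ _)
  have hone : ∀ a ∈ d :: ds, ∀ b ∈ r :: rs,
      partialCell (s.extend a b) m ∈ insert (partialCell s m) T := by
    intro a ha b hb
    have := rank_extend (hdfree a ha) (hrfree b hb)
    refine Or.inr (hT (partialCell_mem_fullCells ?_ ?_))
    · rw [Set.mem_Ioc]; omega
    · omega
  have htwo : ∀ a ∈ ds, ∀ b ∈ rs,
      partialCell ((s.extend a r).extend d b) m ∈ insert (partialCell s m) T := by
    intro a ha b hb
    have hd0 := hdfree d List.mem_cons_self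
    have ha0 := hdfree a (List.mem_cons_of_mem _ ha)
    have hr0 := hrfree r List.mem_cons_self
    have hb0 := hrfree b (List.mem_cons_of_mem _ hb)
    have hda : d ≠ a := fun h => (List.nodup_cons.mp hdn).1 (h ▸ ha)
    have hrb : b ≠ r := fun h => (List.nodup_cons.mp hrn).1 (h ▸ hb)
    have h1 := rank_extend ha0 hr0
    have h2 : rank ((s.extend a r).extend d b) = rank (s.extend a r) + 1 := by
      apply rank_extend
      · rw [extend_apply hr0, if_neg hda, hd0]
      · rw [extend_symm_apply ha0, if_neg hrb, hb0]
    -- A further free point in `ds` forces `m + 2 ≤ n - rank s`, so the index `m` is legitimate two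
    -- ranks up.
    have := List.length_pos_of_mem ha
    refine Or.inr (hT (partialCell_mem_fullCells ?_ ?_))
    · rw [Set.mem_Ioc]; omega
    · omega
  simp only [List.cons_append, List.nil_append, List.append_assoc]
  rw [runProgram_cons]
  refine subset_occupied_runProgram (fun i hi => ?_) (subset_occupied_copy hμ hsm)
  simp only [List.mem_cons, List.mem_append, List.mem_map, List.mem_flatMap] at hi
  rcases hi with rfl | ⟨a, ha, rfl⟩ | ⟨b, hb, rfl⟩ | ⟨a, ha, b, hb, rfl⟩
  · exact hone d List.mem_cons_self r List.mem_cons_self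
  · exact hone a (List.mem_cons_of_mem _ ha) r List.mem_cons_self
  · exact hone d List.mem_cons_self b (List.mem_cons_of_mem _ hb)
  · exact htwo a ha b hb

theorem subset_occupied_partialPrograms {s : RookMonoid n} {T : Set (Cell n)}
    (hT : fullCells n (Set.Ioc (rank s) (rank s + 2)) ⊆ T) (j : ℕ) (hj : j ≤ n - rank s)
    (hsj : partialCell s j ∈ T) {μ : Memory (Cell n)} (hμ : T ⊆ occupied μ) :
    T ∪ {c | ∃ m ≤ j, c = partialCell s m}
      ⊆ occupied (runProgram ((List.range j).reverse.flatMap (partialProgram s)) μ) := by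
  induction j generalizing T μ with
  | zero =>
    rintro c (hc | ⟨m, hm, rfl⟩)
    · exact hμ hc
    · obtain rfl : m = 0 := by omega
      exact hμ hsj
  | succ j ih =>
    rw [List.range_succ, List.reverse_append, List.reverse_singleton, List.singleton_append,
      List.flatMap_cons, runProgram_append]
    have h1 := subset_occupied_partialProgram (by omega) hT hsj hμ
    refine Set.Subset.trans ?_ (ih (hT.trans (Set.subset_insert _ _)) (by omega)
      (Set.mem_insert _ _) h1)
    rintro c (hc | ⟨m, hm, rfl⟩)
    · exact Or.inl (Or.inr hc)
    · rcases hm.eq_or_lt with rfl | hlt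
      · exact Or.inl (Or.inr hsj)
      · exact Or.inr ⟨m, by omega, rfl⟩

theorem subset_occupied_elementProgram {s : RookMonoid n} {T : Set (Cell n)}
    (hT : fullCells n (Set.Ioc (rank s) (rank s + 2)) ⊆ T) {μ : Memory (Cell n)}
    (hμ : T ⊆ occupied μ) :
    T ∪ {c | ∃ m ≤ n - rank s, c = partialCell s m}
      ⊆ occupied (runProgram (elementProgram s) μ) := by
  have hin : Cell.input s ∈ T := hT (Or.inl ⟨s, rfl⟩)
  have := rank_le s
  rw [elementProgram]
  split_ifs with h
  · rintro c (hc | ⟨m, hm, rfl⟩)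
    · exact subset_occupied_copy hμ hin (Set.mem_insert_of_mem _ hc)
    · obtain rfl : m = 0 := by omega
      exact subset_occupied_copy hμ hin (Set.mem_insert _ _)
  · refine subset_occupied_partialPrograms hT _ le_rfl ?_ hμ
    rw [partialCell, if_neg (by omega), if_pos rfl]
    exact hin

theorem keeps_discardProgram {I : Set ℕ} {s : RookMonoid n} (hs : rank s ∉ I) :
    ∀ i ∈ discardProgram s, i.Keeps (fullCells n I) := by
  intro i hi
  obtain ⟨m, -, rfl⟩ := List.mem_map.mp hi
  rintro (⟨t, ht⟩ | ⟨t, m', ht, -, h⟩)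
  · cases ht
  · rw [partialCell] at h
    split_ifs at h
    cases h
    exact hs ht

theorem fullCells_mono {I J : Set ℕ} (h : I ⊆ J) : fullCells n I ⊆ fullCells n J :=
  Set.union_subset_union_right _ fun _ ⟨s, m, hs, hm, hc⟩ => ⟨s, m, h hs, hm, hc⟩

/-- The recursion looks at most two ranks up, so losing rank `k + 3` does no harm; elements of equal
rank do not use each other's cells, so their order is irrelevant. -/
theorem subset_occupied_stepProgram {order : List (RookMonoid n)} (ho : IsEnumeration order)
    {k : ℕ} {μ : Memory (Cell n)} (hμ : fullCells n (Set.Ioc k (k + 3)) ⊆ occupied μ) :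
    fullCells n (Set.Icc k (k + 2)) ⊆ occupied (runProgram (stepProgram order k) μ) := by
  rw [stepProgram, runProgram_append]
  have h1 : fullCells n (Set.Ioc k (k + 2)) ⊆ occupied (runProgram
      ((order.filter fun s => rank s = k + 3).flatMap discardProgram) μ) := by
    refine subset_occupied_runProgram (fun i hi => ?_) ((fullCells_mono ?_).trans hμ)
    · obtain ⟨s, hs, hi⟩ := List.mem_flatMap.mp hi
      have hs' : rank s = k + 3 := by simpa using (List.mem_filter.mp hs).2
      exact keeps_discardProgram (by rw [hs', Set.mem_Ioc]; omega) i hi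
    · exact Set.Ioc_subset_Ioc_right (by omega)
  have h2 := subset_occupied_flatMap (B := fullCells n (Set.Ioc k (k + 2)))
    (cells := fun s => {c | ∃ m ≤ n - rank s, c = partialCell s m}) (prog := elementProgram)
    (l := order.filter fun s => rank s = k) (fun s hs T hT ν hν => by
      have hs' : rank s = k := by simpa using (List.mem_filter.mp hs).2
      exact subset_occupied_elementProgram (hs' ▸ hT) hν) subset_rfl h1
  refine Set.Subset.trans ?_ h2
  rintro c (hc | ⟨s, m, hs, hm, rfl⟩)
  · exact Or.inl (Or.inl hc)
  · rcases hs.1.eq_or_lt with h | h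
    · exact Or.inr ⟨s, List.mem_filter.mpr ⟨ho.2 s, by simp [← h]⟩, m, hm, rfl⟩
    · exact Or.inl (partialCell_mem_fullCells ⟨h, hs.2⟩ hm)

/-- The steps for the ranks from `n` down to `k`. -/
def programDownTo (order : List (RookMonoid n)) (k : ℕ) : List (Instr (Cell n)) :=
  ((List.range (n + 1 - k)).map (k + ·)).reverse.flatMap (stepProgram order)

theorem program_eq_append (order : List (RookMonoid n)) {k : ℕ} (hk : k ≤ n + 1) :
    program order
      = programDownTo order k ++ (List.range k).reverse.flatMap (stepProgram order) := by
  rw [program, programDownTo, ← List.flatMap_append, ← List.reverse_append, ← List.range_add]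
  congr 3
  omega

/-- Descending induction from `n + 1`: no element has that rank, so only the inputs are required at
the start. -/
theorem subset_occupied_programDownTo {order : List (RookMonoid n)} (ho : IsEnumeration order)
    (f : RookMonoid n → ℂ) {k : ℕ} (hk : k ≤ n + 1) :
    fullCells n (Set.Icc k (k + 2))
      ⊆ occupied (runProgram (programDownTo order k) (initialMemory f)) := by
  induction hk using Nat.decreasingInduction with
  | self =>
    have : programDownTo order (n + 1) = [] := by simp [programDownTo]
    rw [this]
    rintro c (⟨s, rfl⟩ | ⟨s, m, hs, -, -⟩)
    · simp [mem_occupied, runProgram, initialMemory]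
    · have := rank_le s
      have := hs.1
      omega
  | of_succ k hk ih =>
    have : programDownTo order k = programDownTo order (k + 1) ++ stepProgram order k := by
      rw [programDownTo, programDownTo, show n + 1 - k = n + 1 - (k + 1) + 1 by omega,
        List.range_succ_eq_map]
      simp [Function.comp_def, add_assoc, add_comm 1]
    rw [this, runProgram_append]
    refine subset_occupied_stepProgram ho ((fullCells_mono ?_).trans ih)
    intro r hr
    exact ⟨hr.1, hr.2⟩

/-! #### Upper bound for the set of occupied cells -/

/-- The inputs, the outputs and the temporary cells of the elements with rank in `I`. -/
def allowedCells (n : ℕ) (I : Set ℕ) : Set (Cell n) :=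
  {c | ∀ s m, c = .work s m → rank s ∈ I ∧ 0 < m ∧ m < n - rank s}

theorem partialCell_mem_allowedCells {I : Set ℕ} {s : RookMonoid n} {m : ℕ} (hs : rank s ∈ I)
    (hm : m ≤ n - rank s) : partialCell s m ∈ allowedCells n I := by
  intro t m' h
  rw [partialCell] at h
  split_ifs at h with h1 h2
  cases h
  exact ⟨hs, by omega, by omega⟩

theorem copy_mem_elementProgram {I : Set ℕ} {s : RookMonoid n} (hs : rank s ∈ I)
    {dst src : Cell n} (h : Instr.copy dst src ∈ elementProgram s) : dst ∈ allowedCells n I := by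
  rw [elementProgram] at h
  split_ifs at h with hn
  · simp only [List.mem_singleton, Instr.copy.injEq] at h
    intro t m ht
    rw [h.1] at ht
    cases ht
  · obtain ⟨m, hm, h⟩ := List.mem_flatMap.mp h
    have hm : m < n - rank s := by simpa using hm
    rw [partialProgram] at h
    split at h
    · simp only [List.cons_append, List.nil_append, List.append_assoc, List.mem_cons,
        List.mem_append, List.mem_map, List.mem_flatMap, Instr.copy.injEq, reduceCtorEq,
        and_false, exists_false, or_false] at h
      rw [h.1]
      exact partialCell_mem_allowedCells hs hm.le
    · simp at h

theorem copy_mem_stepProgram {order : List (RookMonoid n)} {k : ℕ} {I : Set ℕ} (hk : k ∈ I)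
    {dst src : Cell n} (h : Instr.copy dst src ∈ stepProgram order k) :
    dst ∈ allowedCells n I := by
  rw [stepProgram] at h
  rcases List.mem_append.mp h with h | h
  · obtain ⟨s, -, h⟩ := List.mem_flatMap.mp h
    obtain ⟨m, -, h⟩ := List.mem_map.mp h
    cases h
  · obtain ⟨s, hs, h⟩ := List.mem_flatMap.mp h
    have hs' : rank s = k := by simpa using (List.mem_filter.mp hs).2
    exact copy_mem_elementProgram (hs' ▸ hk) h

theorem allowedCells_mono {I J : Set ℕ} (h : I ⊆ J) : allowedCells n I ⊆ allowedCells n J :=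
  fun _ hc s m hs => ⟨h (hc s m hs).1, (hc s m hs).2⟩

theorem occupied_stepProgram_subset {order : List (RookMonoid n)} (ho : IsEnumeration order)
    {k : ℕ} {μ : Memory (Cell n)} (hμ : occupied μ ⊆ allowedCells n (Set.Ioc k (k + 3))) :
    occupied (runProgram (stepProgram order k) μ) ⊆ allowedCells n (Set.Ico k (k + 3)) := by
  rw [stepProgram, runProgram_append]
  refine occupied_runProgram_subset (fun dst src h => ?_) ?_
  · obtain ⟨s, hs, h⟩ := List.mem_flatMap.mp h
    have hs' : rank s = k := by simpa using (List.mem_filter.mp hs).2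
    exact copy_mem_elementProgram (by rw [hs', Set.mem_Ico]; omega) h
  · set p := (order.filter fun s => rank s = k + 3).flatMap discardProgram with hp
    have hdisc : ∀ i ∈ p, ∃ c, i = .discard c := by
      intro i hi
      obtain ⟨s, -, h⟩ := List.mem_flatMap.mp hi
      obtain ⟨m, -, h⟩ := List.mem_map.mp h
      exact ⟨_, h.symm⟩
    have h1 : occupied (runProgram p μ) ⊆ allowedCells n (Set.Ioc k (k + 3)) :=
      occupied_runProgram_subset (fun dst src h => by obtain ⟨_, h⟩ := hdisc _ h; cases h) hμ
    rintro c hc s m rfl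
    obtain ⟨h2, h3⟩ := h1 hc s m rfl
    refine ⟨⟨h2.1.le, lt_of_le_of_ne h2.2 fun h => ?_⟩, h3⟩
    -- The discards reach only indices below `n - rank s`; this is why `allowedCells` records the
    -- range of `m`.
    refine notMem_occupied_of_discard hdisc (List.mem_flatMap.mpr ⟨s, ?_, ?_⟩) μ hc
    · exact List.mem_filter.mpr ⟨ho.2 s, by simp [h]⟩
    · exact List.mem_map.mpr ⟨m, List.mem_range.mpr h3.2, rfl⟩

/-- A run stopped inside the step of rank `k` may still hold cells of rank `k + 3` and may already
hold some of rank `k`, hence four ranks; a completed step restores the window of three. -/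
theorem occupied_take_steps_subset {order : List (RookMonoid n)} (ho : IsEnumeration order)
    (K t : ℕ) {μ : Memory (Cell n)}
    (hμ : occupied μ ⊆ allowedCells n (Set.Ico K (K + 3))) :
    ∃ k, occupied (runProgram (((List.range K).reverse.flatMap (stepProgram order)).take t) μ)
      ⊆ allowedCells n (Set.Icc k (k + 3)) := by
  induction K generalizing t μ with
  | zero => exact ⟨0, by simpa [runProgram] using hμ.trans (allowedCells_mono Set.Ico_subset_Icc_self)⟩
  | succ k ih =>
    rw [List.range_succ, List.reverse_append, List.reverse_singleton, List.singleton_append,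
      List.flatMap_cons, List.take_append, runProgram_append]
    have hμ' : occupied μ ⊆ allowedCells n (Set.Ioc k (k + 3)) :=
      hμ.trans (allowedCells_mono fun r hr => ⟨hr.1, by have := hr.2; omega⟩)
    rcases le_total t (stepProgram order k).length with ht | ht
    · refine ⟨k, ?_⟩
      rw [Nat.sub_eq_zero_of_le ht, List.take_zero]
      refine occupied_runProgram_subset (p := (stepProgram order k).take t) (fun dst src h => ?_)
        (hμ'.trans (allowedCells_mono Set.Ioc_subset_Icc_self))
      exact copy_mem_stepProgram (by rw [Set.mem_Icc]; omega) (List.mem_of_mem_take h)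
    · rw [List.take_of_length_le ht]
      exact ih _ (occupied_stepProgram_subset ho hμ')

theorem occupied_take_program_subset {order : List (RookMonoid n)} (ho : IsEnumeration order)
    (f : RookMonoid n → ℂ) (t : ℕ) :
    ∃ k, occupied (runProgram ((program order).take t) (initialMemory f))
      ⊆ allowedCells n (Set.Icc k (k + 3)) := by
  refine occupied_take_steps_subset ho (n + 1) t ?_
  rintro c hc s m rfl
  simp [mem_occupied, initialMemory] at hc

end FastZeta

/-! ### The rank numbers form a corank sequence -/

namespace RookMonoid

theorem isCorankSequence_card (n : ℕ) :
    IsCorankSequence n fun j => ((corankLevel n j).card : ℝ) where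
  nonneg _ := Nat.cast_nonneg _
  rel j := by exact_mod_cast card_corankLevel_succ j

theorem sum_card_corankLevel_cast (n : ℕ) :
    ∑ j ∈ Finset.range (n + 1), ((corankLevel n j).card : ℝ) = Nat.card (RookMonoid n) := by
  exact_mod_cast sum_card_corankLevel

end RookMonoid

namespace FastZeta

open RookMonoid

variable {n : ℕ}

/-! ### Counting cells -/

/-- The temporary cells of the elements with corank in `J`. -/
noncomputable def workCells (n : ℕ) (J : Finset ℕ) : Finset (Cell n) :=
  ((Finset.univ.filter fun s : RookMonoid n => n - rank s ∈ J).sigma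
    fun s => Finset.Ioo 0 (n - rank s)).map
      ⟨fun x => .work x.1 x.2, fun x y h => by cases x; cases y; cases h; rfl⟩

theorem work_mem_workCells {J : Finset ℕ} {s : RookMonoid n} {m : ℕ} (hs : n - rank s ∈ J)
    (hm : 0 < m) (hm' : m < n - rank s) : Cell.work s m ∈ workCells n J :=
  Finset.mem_map.mpr ⟨⟨s, m⟩, by simp [hs, hm, hm'], rfl⟩

theorem card_workCells (J : Finset ℕ) :
    (workCells n J).card = ∑ j ∈ J, if j ≤ n then (corankLevel n j).card * (j - 1) else 0 := by
  rw [workCells, Finset.card_map, Finset.card_sigma, ← sum_filter_corank]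
  simp

theorem allowedCells_subset (k : ℕ) :
    allowedCells n (Set.Icc k (k + 3)) ⊆
      ((Finset.univ.image Cell.input ∪ Finset.univ.image Cell.output
        ∪ workCells n (Finset.Icc (n - (k + 3)) (n - k)) : Finset (Cell n)) : Set (Cell n)) := by
  intro c hc
  rw [Finset.mem_coe]
  cases c with
  | input s => simp
  | output s => simp
  | work s m =>
    obtain ⟨h1, h2, h3⟩ := hc s m rfl
    obtain ⟨h4, h5⟩ := h1
    refine Finset.mem_union_right _ (work_mem_workCells ?_ h2 h3)
    rw [Finset.mem_Icc]
    omega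

theorem finite_allowedCells (k : ℕ) : (allowedCells n (Set.Icc k (k + 3))).Finite :=
  (Finset.finite_toSet _).subset (allowedCells_subset k)

/-- The constant is `66 = 2 + 4 * 16`: inputs and outputs, then four levels bounded by
`IsCorankSequence.mul_le`. -/
theorem ncard_allowedCells_le (hn : 100 ≤ n) (k : ℕ) :
    ((allowedCells n (Set.Icc k (k + 3))).ncard : ℝ) ≤ 66 * rookBound n := by
  set x : ℝ := (n : ℝ) ^ ((1 : ℝ) / 4) with hx
  have hx1 : 1 ≤ x := Real.one_le_rpow (by exact_mod_cast (by omega : 1 ≤ n)) (by norm_num)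
  set R : ℝ := (Nat.card (RookMonoid n) : ℝ) with hR
  have hcard : (Finset.univ : Finset (RookMonoid n)).card = Nat.card (RookMonoid n) := by
    rw [Nat.card_eq_fintype_card, Finset.card_univ]
  have hwork : ((workCells n (Finset.Icc (n - (k + 3)) (n - k))).card : ℝ) ≤ 4 * (16 * (x * R)) := by
    have hxR : 0 ≤ 16 * (x * R) := by positivity
    rw [card_workCells]
    push_cast
    have hle : ∀ j ∈ Finset.Icc (n - (k + 3)) (n - k),
        (if j ≤ n then ((corankLevel n j).card : ℝ) * ((j - 1 : ℕ) : ℝ) else 0) ≤ 16 * (x * R) := by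
      intro j _
      split_ifs
      · have h1 := (isCorankSequence_card n).mul_le hn j
        rw [sum_card_corankLevel_cast] at h1
        refine le_trans ?_ h1
        rw [mul_comm]
        gcongr
        exact Nat.sub_le _ _
      · exact hxR
    refine (Finset.sum_le_card_nsmul _ _ _ hle).trans ?_
    rw [nsmul_eq_mul]
    refine mul_le_mul_of_nonneg_right ?_ hxR
    rw [Nat.card_Icc]
    exact_mod_cast (by omega : n - k + 1 - (n - (k + 3)) ≤ 4)
  have h1 := Set.ncard_le_ncard (allowedCells_subset (n := n) k) (Finset.finite_toSet _)
  rw [Set.ncard_coe_finset] at h1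
  have h2 := h1.trans (Finset.card_union_le _ _)
  have h3 := Finset.card_union_le ((Finset.univ : Finset (RookMonoid n)).image Cell.input)
    ((Finset.univ : Finset (RookMonoid n)).image Cell.output)
  have h4 := Finset.card_image_le (s := (Finset.univ : Finset (RookMonoid n))) (f := Cell.input)
  have h5 := Finset.card_image_le (s := (Finset.univ : Finset (RookMonoid n))) (f := Cell.output)
  rw [hcard] at h4 h5
  have h6 : (allowedCells n (Set.Icc k (k + 3))).ncard ≤ 2 * Nat.card (RookMonoid n)
      + (workCells n (Finset.Icc (n - (k + 3)) (n - k))).card := by omega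
  have h7 : ((allowedCells n (Set.Icc k (k + 3))).ncard : ℝ) ≤ 2 * R
      + ((workCells n (Finset.Icc (n - (k + 3)) (n - k))).card : ℝ) := by
    rw [hR]; exact_mod_cast h6
  have h8 : R ≤ x * R := le_mul_of_one_le_left (by positivity) hx1
  rw [rookBound, ← hx, ← hR]
  linarith

theorem memoryUse_le (hn : 100 ≤ n) {order : List (RookMonoid n)} (ho : IsEnumeration order)
    (f : RookMonoid n → ℂ) (t : ℕ) : (memoryUse order f t : ℝ) ≤ 66 * rookBound n := by
  obtain ⟨k, hk⟩ := occupied_take_program_subset ho f t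
  refine le_trans ?_ (ncard_allowedCells_le hn k)
  exact_mod_cast Set.ncard_le_ncard hk (finite_allowedCells k)

theorem peakMemory_le (hn : 100 ≤ n) {order : List (RookMonoid n)} (ho : IsEnumeration order)
    (f : RookMonoid n → ℂ) : (peakMemory order f : ℝ) ≤ 66 * rookBound n := by
  obtain ⟨t, -, ht⟩ := Finset.exists_mem_eq_sup (Finset.range ((program order).length + 1))
    ⟨0, by simp⟩ (memoryUse order f)
  rw [peakMemory, ht]
  exact memoryUse_le hn ho f t

theorem memoryUse_le_peakMemory (order : List (RookMonoid n)) (f : RookMonoid n → ℂ) {t : ℕ}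
    (ht : t ≤ (program order).length) : memoryUse order f t ≤ peakMemory order f :=
  Finset.le_sup (f := memoryUse order f) (Finset.mem_range.mpr (by omega))

theorem workCells_subset_fullCells {q : ℕ} (hq : 3 ≤ q) (hqn : q ≤ n) :
    ((workCells n (Finset.Icc (q - 2) q) : Finset (Cell n)) : Set (Cell n))
      ⊆ fullCells n (Set.Icc (n - q) (n - q + 2)) := by
  intro c hc
  obtain ⟨⟨s, m⟩, hx, rfl⟩ := Finset.mem_map.mp hc
  simp only [Finset.mem_sigma, Finset.mem_filter, Finset.mem_univ, true_and, Finset.mem_Icc,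
    Finset.mem_Ioo] at hx
  refine Or.inr ⟨s, m, ⟨?_, ?_⟩, by omega, ?_⟩
  · omega
  · omega
  · rw [partialCell, if_neg (by omega), if_neg (by omega)]
    rfl

/-- At the end of the step for rank `q ^ 2 - q`, the memory is large. -/
theorem exists_le_memoryUse {q : ℕ} (hq : 16 ≤ q) {order : List (RookMonoid (q ^ 2))}
    (ho : IsEnumeration order) (f : RookMonoid (q ^ 2) → ℂ) :
    ∃ t ≤ (program order).length,
      (1 / 3 : ℝ) * rookBound (q ^ 2) ≤ (memoryUse order f t : ℝ) := by
  have hqn : q ≤ q ^ 2 := Nat.le_self_pow two_ne_zero q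
  have happ := program_eq_append order (k := q ^ 2 - q) (by omega)
  refine ⟨(programDownTo order (q ^ 2 - q)).length, by rw [happ]; simp, ?_⟩
  -- The upper bound on the occupied cells serves here only to make them a finite set, without which
  -- `ncard` would not be monotone.
  obtain ⟨k, hk⟩ := occupied_take_program_subset ho f (programDownTo order (q ^ 2 - q)).length
  have hsub := (workCells_subset_fullCells (by omega) hqn).trans
    (subset_occupied_programDownTo ho f (k := q ^ 2 - q) (by omega))
  have htake : (program order).take (programDownTo order (q ^ 2 - q)).length
      = programDownTo order (q ^ 2 - q) := by rw [happ, List.take_left]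
  rw [← htake] at hsub
  have h1 := Set.ncard_le_ncard hsub ((finite_allowedCells k).subset hk)
  rw [Set.ncard_coe_finset, card_workCells] at h1
  have h2 : ((∑ j ∈ Finset.Icc (q - 2) q,
      if j ≤ q ^ 2 then (corankLevel (q ^ 2) j).card * (j - 1) else 0 : ℕ) : ℝ)
      ≤ (memoryUse order f (programDownTo order (q ^ 2 - q)).length : ℝ) := by exact_mod_cast h1
  refine le_trans ?_ h2
  have h3 := (isCorankSequence_card (q ^ 2)).rpow_mul_sum_le hq (q ^ 2 + 1)
  rw [sum_card_corankLevel_cast] at h3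
  refine h3.trans (le_of_eq ?_)
  obtain ⟨p, rfl⟩ : ∃ p, q = p + 3 := ⟨q - 3, by omega⟩
  have hIcc : Finset.Icc (p + 3 - 2) (p + 3) = {p + 1, p + 2, p + 3} := by
    ext j
    simp only [Finset.mem_Icc, Finset.mem_insert, Finset.mem_singleton]
    omega
  rw [hIcc, Finset.sum_insert (by simp), Finset.sum_insert (by simp), Finset.sum_singleton,
    if_pos (by omega), if_pos (by omega), if_pos (by omega)]
  simp only [Nat.add_sub_cancel, show p + 3 - 1 = p + 2 from rfl, show p + 3 - 2 = p + 1 from rfl,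
    show p + 2 - 1 = p + 1 from rfl]
  push_cast
  ring

end FastZeta

/-! ### Asymptotic conclusions -/

theorem rookBound_pos {n : ℕ} (hn : 0 < n) : 0 < rookBound n :=
  mul_pos (Real.rpow_pos_of_pos (by exact_mod_cast hn) _) (by
    have : Nonempty (RookMonoid n) := ⟨⊥⟩
    exact_mod_cast Nat.card_pos)

theorem mainTheorem8 :
    -- all large perfect squares, uniformly in the order of treatment and in the input
    (∃ N : ℕ, ∀ n : ℕ, N ≤ n → IsSquare n →
      ∀ order : List (RookMonoid n), FastZeta.IsEnumeration order → ∀ f : RookMonoid n → ℂ,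
        ∃ t ≤ (FastZeta.program order).length,
          (1 / 3 : ℝ) * rookBound n ≤ (FastZeta.memoryUse order f t : ℝ)) ∧
    -- in particular infinitely many `n`
    {n : ℕ | ∀ order : List (RookMonoid n), FastZeta.IsEnumeration order →
      ∀ f : RookMonoid n → ℂ,
        ∃ t ≤ (FastZeta.program order).length,
          (1 / 3 : ℝ) * rookBound n ≤ (FastZeta.memoryUse order f t : ℝ)}.Infinite ∧
    -- the upper bound `O(n^{1/4} |R_n|)` for the peak memory holds and is sharp
    (∀ order : (n : ℕ) → List (RookMonoid n), (∀ n, FastZeta.IsEnumeration (order n)) →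
      ∀ f : (n : ℕ) → RookMonoid n → ℂ,
        ((fun n : ℕ => (FastZeta.peakMemory (order n) (f n) : ℝ)) =O[Filter.atTop] rookBound) ∧
        ¬ ((fun n : ℕ => (FastZeta.peakMemory (order n) (f n) : ℝ))
            =o[Filter.atTop] rookBound)) := by
  have hlow : ∀ n : ℕ, 256 ≤ n → IsSquare n → ∀ order : List (RookMonoid n),
      FastZeta.IsEnumeration order → ∀ f : RookMonoid n → ℂ,
        ∃ t ≤ (FastZeta.program order).length,
          (1 / 3 : ℝ) * rookBound n ≤ (FastZeta.memoryUse order f t : ℝ) := by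
    rintro n hn ⟨q, rfl⟩
    rw [← pow_two] at hn ⊢
    exact fun order ho f => FastZeta.exists_le_memoryUse (by nlinarith) ho f
  refine ⟨⟨256, hlow⟩, ?_, fun order ho f => ⟨?_, fun hlittle => ?_⟩⟩
  · refine Set.infinite_of_forall_exists_gt fun b => ⟨(b + 16) ^ 2, ?_, by nlinarith⟩
    exact hlow _ (Nat.pow_le_pow_left (Nat.le_add_left 16 b) 2) (IsSquare.sq _)
  · refine Asymptotics.IsBigO.of_bound 66 (Filter.eventually_atTop.mpr ⟨100, fun n hn => ?_⟩)
    rw [Real.norm_of_nonneg (Nat.cast_nonneg _),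
      Real.norm_of_nonneg (rookBound_pos (by omega)).le]
    exact FastZeta.peakMemory_le hn (ho n) (f n)
  -- Any constant below `1 / 3` contradicts the lower bound at a large square.
  · obtain ⟨N, hN⟩ := Filter.eventually_atTop.mp (hlittle.def (c := 1 / 4) (by norm_num))
    have h1 := hN ((N + 16) ^ 2) (by nlinarith)
    have hpos := rookBound_pos (n := (N + 16) ^ 2) (by positivity)
    rw [Real.norm_of_nonneg (Nat.cast_nonneg _), Real.norm_of_nonneg hpos.le] at h1
    obtain ⟨t, ht, h2⟩ := hlow ((N + 16) ^ 2) (Nat.pow_le_pow_left (Nat.le_add_left 16 N) 2)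
      (IsSquare.sq _) _ (ho _) (f _)
    have h3 : (FastZeta.memoryUse (order ((N + 16) ^ 2)) (f ((N + 16) ^ 2)) t : ℝ)
        ≤ (FastZeta.peakMemory (order ((N + 16) ^ 2)) (f ((N + 16) ^ 2)) : ℝ) := by
      exact_mod_cast FastZeta.memoryUse_le_peakMemory _ _ ht
    linarith
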